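/- Let $p>2$ be a prime and let $G$ be a nontrivial finite $p$-group of nilpotency class $c$. Let $\gamma_1(G)=G$ and $\gamma_{i+1}(G)=[\gamma_i(G),G]$ for $i\ge 1$ be the lower central series of $G$, and let $d\ge 1$ be the largest integer such that $\exp(\gamma_d(G))=\exp(G)$, where $\exp$ denotes the exponent of a group. Suppose that $d\ge c-5$. Then: (1) $G$ is a $J$-group, that is, there exist an element $k\in G$ and a function $f\colon G\to G$ such that $f(xk)=x\,f(x)$ for all $x\in G$; (2) $\mathcal{B}(\gamma_d(G))\subseteq\mathcal{W}(G)$. Here $\mathcal{B}(H)=\{h\in H: |h|=\exp(H)\}$ is the set of elements of a finite group $H$ whose order equals the exponent of $H$, and $\mathcal{W}(G)$ is the set of witnesses for $G$, i.e. of the elements $k\in G$, of order $n=|k|$ say, such that the ordered product $$\prod_{i=1}^{n}xk^{n-i}=xk^{n-1}\,xk^{n-2}\cdots xk^2\,xk\,x$$ equals $1$ for all $x\in G$. -/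

import Mathlib

namespace JGroups

/-- A group `G` is a *J-group* if there are an element `k` and a function `f : G → G` such that
`f (x * k) = x * f x` for all `x`. -/
def IsJGroup (G : Type*) [Group G] : Prop :=
  ∃ (k : G) (f : G → G), ∀ x : G, f (x * k) = x * f x

/-- The ordered product `x k ^ (n - 1) * x k ^ (n - 2) * ⋯ * x k * x`, that is, the product of
`x k ^ (n - i)` for `i = 1, …, n` taken from left to right. -/
def witnessProd {G : Type*} [Group G] (k x : G) (n : ℕ) : G :=
  ((List.range n).map fun i => x * k ^ (n - (i + 1))).prod

/-- The set `𝓦(G)` of witnesses of `G`: the elements `k` of finite order `n` such that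
`x k ^ (n - 1) * x k ^ (n - 2) * ⋯ * x k * x = 1` for all `x`. -/
def witnesses (G : Type*) [Group G] : Set G :=
  {k | IsOfFinOrder k ∧ ∀ x : G, witnessProd k x (orderOf k) = 1}

/-- The set `𝓑(G)` of big elements of `G`: those whose order is the exponent of `G`. -/
def bigElements (G : Type*) [Group G] : Set G :=
  {x | orderOf x = Monoid.exponent G}

/-- The term `γ_i(G)` of the lower central series, indexed from `i = 1`, so that `γ_1(G) = G` and
`γ_{i+1}(G) = [γ_i(G), G]`. Only the values at `i ≥ 1` are meaningful. -/
def gamma (G : Type*) [Group G] (i : ℕ) : Subgroup G :=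
  (⊤ : Subgroup G).lowerCentralSeries (i - 1)

end JGroups

/-! ### Filtrations of a group. -/

namespace JGroups

open commutatorElement

/-! Let `exp G = p ^ e`. If `k ^ n = 1` with `n` odd, collecting powers of `k` turns the witness
product into a product of conjugates of `x` by `k` to triangular exponents
(`witnessProd_eq_conjProd`). That product is a polynomial sequence evaluated at `n`, vanishing at
`0`, so its Taylor expansion reduces the claim to `a ^ n.choose j = 1` for `a ∈ F j`, `j ≥ 1`, where
`F` is a suitable filtration (`witnessProd_eq_one`).

As `p ^ e ∣ j * (p ^ e).choose j`, at most one factor `p` is lost unless `p ^ 2 ∣ j`, and by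
maximality of `d` the group `γ_{d+1}` has exponent dividing `p ^ (e - 1)`. For `d ≥ 2` the
filtration `deepFiltration` vanishes from index 8 on, before the first bad index 9. For `d = 1` the
class is at most 6 and indices up to 11 occur; `sixFiltration` is built so that its ninth term is
generated by cubes, which repairs `p = 3`, `j = 9`.

A big element of `γ_d` exists because `γ_d` is a `p`-group, and any witness yields a J-group. -/

/-- A descending family of subgroups with `⁅F i, F j⁆ ≤ F (i + j)`. -/
structure IsFiltration {G : Type*} [Group G] (F : ℕ → Subgroup G) : Prop where
  succ_le : ∀ i, F (i + 1) ≤ F i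
  commutator_le : ∀ i j, ⁅F i, F j⁆ ≤ F (i + j)

namespace IsFiltration

variable {G : Type*} [Group G] {F : ℕ → Subgroup G}

theorem antitone (hF : IsFiltration F) : Antitone F :=
  antitone_nat_of_succ_le hF.succ_le

theorem commutator_mem (hF : IsFiltration F) {i j m : ℕ} {a b : G} (ha : a ∈ F i) (hb : b ∈ F j)
    (h : m ≤ i + j) : ⁅a, b⁆ ∈ F m :=
  hF.antitone h (hF.commutator_le i j (Subgroup.commutator_mem_commutator ha hb))

theorem conj_mem (hF : IsFiltration F) {i j : ℕ} {a b : G} (ha : a ∈ F i) (hb : b ∈ F j) :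
    a * b * a⁻¹ ∈ F j := by
  have h := mul_mem (hF.commutator_mem ha hb (Nat.le_add_left j i)) hb
  rwa [commutatorElement_def, inv_mul_cancel_right] at h

theorem conj_mem' (hF : IsFiltration F) {i j : ℕ} {a b : G} (ha : a ∈ F i) (hb : b ∈ F j) :
    a⁻¹ * b * a ∈ F j := by
  simpa using hF.conj_mem (inv_mem ha) hb

end IsFiltration

/-- The left difference `n ↦ (g n)⁻¹ * g (n + 1)` of a sequence in a group. -/
def fdiff {G : Type*} [Group G] (g : ℕ → G) : ℕ → G := fun n => (g n)⁻¹ * g (n + 1)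

section fdiff

variable {G : Type*} [Group G]

theorem fdiff_one : fdiff (1 : ℕ → G) = 1 := by
  funext n; simp [fdiff]

theorem fdiff_mul (g h : ℕ → G) : fdiff (g * h) = h⁻¹ * fdiff g * h * fdiff h := by
  funext n; simp only [fdiff, Pi.mul_apply, Pi.inv_apply]; group

theorem fdiff_inv (g : ℕ → G) : fdiff g⁻¹ = g * (fdiff g)⁻¹ * g⁻¹ := by
  funext n; simp only [fdiff, Pi.mul_apply, Pi.inv_apply]; group

theorem fdiff_commutator (g h : ℕ → G) :
    fdiff ⁅g, h⁆ = h * (g * (fdiff g * ⁅(fdiff g)⁻¹, h⁻¹⁆ * (fdiff g)⁻¹ * ⁅fdiff g, fdiff h⁆) *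
      g⁻¹ * ⁅g, fdiff h⁆) * h⁻¹ := by
  funext n
  simp only [fdiff, Pi.mul_apply, Pi.inv_apply, commutatorElement_def]; group

end fdiff

/-- `IsPoly F n i g` says that the iterated differences of `g` of order `l ≤ n` take their values
in `F (i + l)`. -/
def IsPoly {G : Type*} [Group G] (F : ℕ → Subgroup G) : ℕ → ℕ → (ℕ → G) → Prop
  | 0, i, g => ∀ m, g m ∈ F i
  | n + 1, i, g => IsPoly F n i g ∧ IsPoly F n (i + 1) (fdiff g)

/-! ### Polynomial sequences and their Taylor expansions. -/

section poly

variable {G : Type*} [Group G] {F : ℕ → Subgroup G}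

/-- The Lazard–Leibman theorem, truncated at `n` differences. Proving that the sequences themselves
form a filtration makes the induction close: the difference of a product, inverse or commutator is
built from conjugates and commutators controlled one stage earlier. -/
theorem exists_filtration_isPoly (hF : IsFiltration F) (n : ℕ) :
    ∃ Q : ℕ → Subgroup (ℕ → G), IsFiltration Q ∧ ∀ i g, g ∈ Q i ↔ IsPoly F n i g := by
  induction n with
  | zero =>
    refine ⟨fun i => Subgroup.pi Set.univ fun _ => F i, ⟨?_, ?_⟩, ?_⟩
    · intro i g hg m hm
      exact hF.succ_le i (hg m hm)
    · intro i j
      rw [Subgroup.commutator_le]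
      intro g hg h hh m hm
      exact hF.commutator_mem (hg m hm) (hh m hm) le_rfl
    · intro i g
      exact ⟨fun h m => h m trivial, fun h m _ => h m⟩
  | succ n ih =>
    obtain ⟨Q, hQ, hmem⟩ := ih
    refine ⟨fun i =>
      { carrier := {g | g ∈ Q i ∧ fdiff g ∈ Q (i + 1)}
        one_mem' := ⟨one_mem _, by rw [fdiff_one]; exact one_mem _⟩
        mul_mem' := ?_
        inv_mem' := ?_ }, ⟨?_, ?_⟩, ?_⟩
    · rintro g h ⟨hg, hg'⟩ ⟨hh, hh'⟩
      refine ⟨mul_mem hg hh, ?_⟩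
      rw [fdiff_mul]
      exact mul_mem (hQ.conj_mem' hh hg') hh'
    · rintro g ⟨hg, hg'⟩
      refine ⟨inv_mem hg, ?_⟩
      rw [fdiff_inv]
      exact hQ.conj_mem hg (inv_mem hg')
    · rintro i g ⟨hg, hg'⟩
      exact ⟨hQ.succ_le _ hg, hQ.succ_le _ hg'⟩
    · intro i j
      rw [Subgroup.commutator_le]
      rintro g ⟨hg, hg'⟩ h ⟨hh, hh'⟩
      refine ⟨hQ.commutator_mem hg hh le_rfl, ?_⟩
      rw [fdiff_commutator]
      -- Each commutator left after removing conjugations involves a difference, hence has weight at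
      -- least `i + j + 1`.
      refine hQ.conj_mem hh (mul_mem (hQ.conj_mem hg (mul_mem (hQ.conj_mem hg' ?_) ?_)) ?_)
      · exact hQ.commutator_mem (inv_mem hg') (inv_mem hh) (by omega)
      · exact hQ.commutator_mem hg' hh' (by omega)
      · exact hQ.commutator_mem hg hh' (by omega)
    · intro i g
      change g ∈ Q i ∧ fdiff g ∈ Q (i + 1) ↔ _
      rw [hmem, hmem]; rfl

/-- The group of polynomial sequences of level `i` for the filtration `F`. -/
def polySeq (F : ℕ → Subgroup G) (hF : IsFiltration F) (i : ℕ) : Subgroup (ℕ → G) where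
  carrier := {g | ∀ n, IsPoly F n i g}
  one_mem' n := by
    obtain ⟨Q, -, h⟩ := exists_filtration_isPoly hF n
    exact (h i _).1 (one_mem _)
  mul_mem' ha hb n := by
    obtain ⟨Q, -, h⟩ := exists_filtration_isPoly hF n
    exact (h i _).1 (mul_mem ((h i _).2 (ha n)) ((h i _).2 (hb n)))
  inv_mem' ha n := by
    obtain ⟨Q, -, h⟩ := exists_filtration_isPoly hF n
    exact (h i _).1 (inv_mem ((h i _).2 (ha n)))

theorem mem_polySeq_iff (hF : IsFiltration F) {i : ℕ} {g : ℕ → G} :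
    g ∈ polySeq F hF i ↔ (∀ m, g m ∈ F i) ∧ fdiff g ∈ polySeq F hF (i + 1) := by
  constructor
  · intro h
    exact ⟨h 0, fun n => (h (n + 1)).2⟩
  · rintro ⟨h0, h⟩ n
    induction n with
    | zero => exact h0
    | succ n ih => exact ⟨ih, h n⟩

theorem isFiltration_polySeq (hF : IsFiltration F) : IsFiltration (polySeq F hF) := by
  constructor
  · intro i g hg n
    obtain ⟨Q, hQ, h⟩ := exists_filtration_isPoly hF n
    exact (h i _).1 (hQ.succ_le i ((h (i + 1) _).2 (hg n)))
  · intro i j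
    rw [Subgroup.commutator_le]
    intro g hg g' hg' n
    obtain ⟨Q, hQ, h⟩ := exists_filtration_isPoly hF n
    exact (h _ _).1 (hQ.commutator_mem ((h i _).2 (hg n)) ((h j _).2 (hg' n)) le_rfl)

theorem shift_mem_polySeq (hF : IsFiltration F) {i : ℕ} {g : ℕ → G} (hg : g ∈ polySeq F hF i)
    (s : ℕ) : (fun n => g (n + s)) ∈ polySeq F hF i := by
  have key : ∀ n i (g : ℕ → G), IsPoly F n i g → IsPoly F n i fun n => g (n + s) := by
    intro n
    induction n with
    | zero => exact fun i g h m => h (m + s)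
    | succ n ih =>
      intro i g h
      refine ⟨ih i g h.1, ?_⟩
      have := ih _ _ h.2
      have e : (fun n => fdiff g (n + s)) = fdiff fun n => g (n + s) := by
        funext m
        simp only [fdiff, add_right_comm]
      rwa [e] at this
  exact fun n => key n i g (hg n)

theorem pow_choose_mem_polySeq (hF : IsFiltration F) {i j : ℕ} {a : G} (ha : a ∈ F (i + j)) :
    (fun n : ℕ => a ^ n.choose j) ∈ polySeq F hF i := by
  induction j generalizing i with
  | zero =>
    rw [mem_polySeq_iff]
    refine ⟨fun m => by simpa using ha, ?_⟩
    have : fdiff (fun n : ℕ => a ^ n.choose 0) = 1 := by funext n; simp [fdiff]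
    rw [this]; exact one_mem _
  | succ j ih =>
    rw [mem_polySeq_iff]
    refine ⟨fun m => pow_mem (hF.antitone (Nat.le_add_right _ _) ha) _, ?_⟩
    have : fdiff (fun n : ℕ => a ^ n.choose (j + 1)) = fun n : ℕ => a ^ n.choose j := by
      funext n
      simp only [fdiff, Nat.choose_succ_succ']
      rw [add_comm (n.choose j), pow_add, inv_mul_cancel_left]
    rw [this]
    exact ih (by rwa [add_right_comm, add_assoc])

theorem const_mem_polySeq (hF : IsFiltration F) {i : ℕ} {a : G} (ha : a ∈ F i) :
    (fun _ : ℕ => a) ∈ polySeq F hF i := by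
  simpa using pow_choose_mem_polySeq hF (i := i) (j := 0) ha

/-- Differencing moves the first possibly nontrivial value one index down without changing it, so `g
r` is the `r`-th difference at `0`. -/
theorem apply_mem_of_forall_lt_eq_one (hF : IsFiltration F) {i r : ℕ} {g : ℕ → G}
    (hg : g ∈ polySeq F hF i) (h : ∀ m < r, g m = 1) : g r ∈ F (i + r) := by
  induction r generalizing i g with
  | zero => exact ((mem_polySeq_iff hF).1 hg).1 0
  | succ r ih =>
    have := ih ((mem_polySeq_iff hF).1 hg).2 fun m hm => by
      simp [fdiff, h m (by omega), h (m + 1) (by omega)]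
    rw [fdiff, h r (Nat.lt_succ_self r), inv_one, one_mul] at this
    rwa [add_right_comm, add_assoc] at this

/-- Partial Taylor products. -/
def taylorProd (c : ℕ → G) (r : ℕ) : ℕ → G :=
  fun n => ((List.range r).map fun j => c j ^ n.choose j).prod

theorem taylorProd_succ (c : ℕ → G) (r : ℕ) :
    taylorProd c (r + 1) = taylorProd c r * fun n => c r ^ n.choose r := by
  funext n
  simp [taylorProd, List.range_succ]

theorem taylorProd_congr {c c' : ℕ → G} {r : ℕ} (h : ∀ j < r, c j = c' j) :
    taylorProd c r = taylorProd c' r := by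
  induction r with
  | zero => rfl
  | succ r ih =>
    rw [taylorProd_succ, taylorProd_succ, ih fun j hj => h j (by omega), h r (by omega)]

theorem taylorProd_mem (hF : IsFiltration F) {i r : ℕ} {c : ℕ → G} (h : ∀ j < r, c j ∈ F (i + j)) :
    taylorProd c r ∈ polySeq F hF i := by
  induction r with
  | zero => exact one_mem (polySeq F hF i)
  | succ r ih =>
    rw [taylorProd_succ]
    exact mul_mem (ih fun j hj => h j (by omega)) (pow_choose_mem_polySeq hF (h r (by omega)))

/-- Taylor expansion of a polynomial sequence. -/
theorem exists_taylor (hF : IsFiltration F) {i : ℕ} {g : ℕ → G} (hg : g ∈ polySeq F hF i) (r : ℕ) :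
    ∃ c : ℕ → G, (∀ j < r, c j ∈ F (i + j)) ∧ ∀ n < r, g n = taylorProd c r n := by
  induction r with
  | zero => exact ⟨1, by simp, by simp⟩
  | succ r ih =>
    obtain ⟨c, hc, hgc⟩ := ih
    -- The next coefficient is the value at `r` of the remainder, which is trivial before `r`.
    have hmem := apply_mem_of_forall_lt_eq_one hF (r := r)
      (mul_mem (inv_mem (taylorProd_mem hF hc)) hg) fun m hm => by simp [hgc m hm]
    have hcongr : taylorProd (Function.update c r ((taylorProd c r)⁻¹ r * g r)) r =
        taylorProd c r := taylorProd_congr fun j hj => Function.update_of_ne hj.ne _ _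
    refine ⟨Function.update c r ((taylorProd c r)⁻¹ r * g r), fun j hj => ?_, fun n hn => ?_⟩
    · rcases Nat.lt_succ_iff_lt_or_eq.1 hj with h | rfl
      · rw [Function.update_of_ne h.ne]; exact hc j h
      · rw [Function.update_self]; exact hmem
    · rw [taylorProd_succ, hcongr]
      rcases Nat.lt_succ_iff_lt_or_eq.1 hn with h | rfl
      · simp [Nat.choose_eq_zero_of_lt h, hgc n h]
      · simp

/-- Taylor expansion of a polynomial sequence for a filtration of finite length. -/
theorem exists_taylor_of_eq_bot (hF : IsFiltration F) {i s : ℕ} (hs : F (i + s) = ⊥) {g : ℕ → G}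
    (hg : g ∈ polySeq F hF i) :
    ∃ c : ℕ → G, (∀ j < s, c j ∈ F (i + j)) ∧ g = taylorProd c s := by
  obtain ⟨c, hc, hgc⟩ := exists_taylor hF hg s
  refine ⟨c, hc, ?_⟩
  have hone : ∀ r, ∀ m < r, ((taylorProd c s)⁻¹ * g) m = 1 := by
    intro r
    induction r with
    | zero => intro m hm; omega
    | succ r ih =>
      intro m hm
      rcases Nat.lt_succ_iff_lt_or_eq.1 hm with h | rfl
      · exact ih m h
      rcases lt_or_ge m s with h | h
      · simp [hgc m h]
      · have := hF.antitone (Nat.add_le_add_left h i) (apply_mem_of_forall_lt_eq_one hF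
          (mul_mem (inv_mem (taylorProd_mem hF hc)) hg) ih)
        rwa [hs, Subgroup.mem_bot] at this
  funext m
  exact (inv_mul_eq_one.1 (hone (m + 1) m (Nat.lt_succ_self m))).symm

theorem apply_eq_one_of_pow_choose (hF : IsFiltration F) {g : ℕ → G} (hg : g ∈ polySeq F hF 0)
    (h0 : g 0 = 1) (N : ℕ) (hN : ∀ j, 1 ≤ j → ∀ a ∈ F j, a ^ N.choose j = 1) : g N = 1 := by
  obtain ⟨c, hc, hgc⟩ := exists_taylor hF hg (N + 1)
  have hc0 : c 0 = 1 := by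
    have h := hgc 0 (Nat.succ_pos N)
    rw [h0, taylorProd, List.prod_range_succ'] at h
    simpa using h.symm
  rw [hgc N (Nat.lt_succ_self N), taylorProd]
  refine List.prod_eq_one fun y hy => ?_
  obtain ⟨j, hj, rfl⟩ := List.mem_map.1 hy
  rcases Nat.eq_zero_or_pos j with rfl | hpos
  · simp [hc0]
  · exact hN j hpos _ (by simpa using hc j (List.mem_range.1 hj))

end poly

/-! ### Witnesses, J-groups and products of conjugates. -/

section witness

variable {G : Type*} [Group G]

theorem witnessProd_zero (k x : G) : witnessProd k x 0 = 1 := rfl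

theorem witnessProd_succ (k x : G) (n : ℕ) :
    witnessProd k x (n + 1) = x * k ^ n * witnessProd k x n := by
  rw [witnessProd, List.prod_range_succ']
  simp [witnessProd]

theorem isJGroup_of_mem_witnesses {k : G} (hk : k ∈ witnesses G) : IsJGroup G := by
  obtain ⟨hfin, hw⟩ := hk
  -- Setting `f (r * k ^ i) = witnessProd k r i` on each coset of `⟨k⟩` is consistent because the
  -- witness condition makes this periodic in `i`.
  have hper : ∀ r : G, Function.Periodic (witnessProd k r) (orderOf k) := by
    intro r i
    induction i with
    | zero => rw [zero_add, hw, witnessProd_zero]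
    | succ i ih =>
      rw [add_right_comm, witnessProd_succ, witnessProd_succ, ih, pow_add, pow_orderOf_eq_one,
        mul_one]
  let r : G → G := fun x => (QuotientGroup.mk x : G ⧸ Subgroup.zpowers k).out
  have hr : ∀ x, ∃ i : ℕ, r x * k ^ i = x := by
    intro x
    have h : (r x)⁻¹ * x ∈ Subgroup.zpowers k :=
      QuotientGroup.eq.1 (Quotient.out_eq' (QuotientGroup.mk x : G ⧸ Subgroup.zpowers k))
    obtain ⟨i, hi⟩ := (hfin.mem_powers_iff_mem_zpowers).2 h
    exact ⟨i, by simp only at hi; rw [hi, mul_inv_cancel_left]⟩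
  choose i hi using hr
  refine ⟨k, fun x => witnessProd k (r x) (i x), fun x => ?_⟩
  have hrk : r (x * k) = r x := by
    have : (QuotientGroup.mk (x * k) : G ⧸ Subgroup.zpowers k) = QuotientGroup.mk x :=
      QuotientGroup.eq.2 (by simp)
    simp only [r, this]
  have hik : k ^ i (x * k) = k ^ (i x + 1) := by
    have h1 : r x * k ^ i (x * k) = r x * k ^ (i x + 1) := by
      have h2 := hi (x * k)
      rw [hrk] at h2
      rw [h2, pow_succ, ← mul_assoc, hi]
    exact mul_left_cancel h1
  have hmod := pow_inj_mod.1 hik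
  calc witnessProd k (r (x * k)) (i (x * k)) = witnessProd k (r x) (i x + 1) := by
        rw [hrk, ← (hper (r x)).map_mod_nat (i (x * k)), hmod, (hper (r x)).map_mod_nat]
    _ = x * witnessProd k (r x) (i x) := by rw [witnessProd_succ, hi]

/-- The product of the conjugates of `x` by the powers of `k` with triangular exponents. -/
def conjProd (k x : G) : ℕ → G
  | 0 => 1
  | m + 1 => conjProd k x m * ((k ^ (m + 1).choose 2)⁻¹ * x * k ^ (m + 1).choose 2)

theorem fdiff_conjProd (k x : G) :
    fdiff (conjProd k x) = fun m => (k ^ (m + 1).choose 2)⁻¹ * x * k ^ (m + 1).choose 2 := by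
  funext m
  simp [fdiff, conjProd]

theorem conjProd_mem (H : Subgroup G) {k x : G}
    (h : ∀ m : ℕ, (k ^ (m + 1).choose 2)⁻¹ * x * k ^ (m + 1).choose 2 ∈ H) (m : ℕ) :
    conjProd k x m ∈ H := by
  induction m with
  | zero => exact one_mem H
  | succ m ih => exact mul_mem ih (h m)

/-- Write `k ^ (n - i) = k ^ (-i)` and push these powers to the right; the accumulated exponents are
triangular numbers. -/
theorem witnessProd_eq_conjProd {k x : G} {n : ℕ} (hk : k ^ n = 1) :
    witnessProd k x n = conjProd k x n * (k ^ (n + 1).choose 2)⁻¹ := by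
  have key : ∀ m ≤ n, ((List.range m).map fun i => x * k ^ (n - (i + 1))).prod =
      conjProd k x m * (k ^ (m + 1).choose 2)⁻¹ := by
    intro m hm
    induction m with
    | zero => simp [conjProd]
    | succ m ih =>
      have h1 : k ^ (n - (m + 1)) = (k ^ (m + 1))⁻¹ := by
        rw [eq_inv_iff_mul_eq_one, ← pow_add, Nat.sub_add_cancel hm, hk]
      have h2 : (m + 1 + 1).choose 2 = (m + 1) + (m + 1).choose 2 := by
        rw [Nat.choose_succ_succ' (m + 1) 1, Nat.choose_one_right]
      rw [List.prod_range_succ, ih (by omega), h1, h2, pow_add, conjProd]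
      group
  exact key n le_rfl

/-- The first difference of `conjProd` is the sequence of conjugates, so level 1 for the latter
gives level 0 for the former. Oddness gives `n ∣ (n + 1).choose 2`, which removes the leftover power
of `k`. -/
theorem witnessProd_eq_one {F : ℕ → Subgroup G} (hF : IsFiltration F) {k x : G}
    (hconj : (fun m : ℕ => (k ^ (m + 1).choose 2)⁻¹ * x * k ^ (m + 1).choose 2) ∈ polySeq F hF 1)
    {n : ℕ} (hodd : Odd n) (hk : k ^ n = 1) (hn : ∀ j, 1 ≤ j → ∀ a ∈ F j, a ^ n.choose j = 1) :
    witnessProd k x n = 1 := by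
  have hT : n ∣ (n + 1).choose 2 := by
    obtain ⟨t, ht⟩ := hodd
    refine ⟨t + 1, ?_⟩
    rw [Nat.choose_two_right, Nat.add_sub_cancel, ht]
    apply Nat.div_eq_of_eq_mul_left two_pos
    ring
  obtain ⟨t, ht⟩ := hT
  have hmem : conjProd k x ∈ polySeq F hF 0 := by
    rw [mem_polySeq_iff, fdiff_conjProd]
    exact ⟨conjProd_mem _ fun m => hF.succ_le 0 (((mem_polySeq_iff hF).1 hconj).1 m), hconj⟩
  rw [witnessProd_eq_conjProd hk, ht, pow_mul, hk, one_pow, inv_one, mul_one]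
  exact apply_eq_one_of_pow_choose hF hmem rfl n hn

end witness

/-! ### The lower central series as a filtration. -/

section gamma

variable {G : Type*} [Group G]

theorem commutator_commutator_le_of_rotate {H₁ H₂ H₃ N : Subgroup G} [N.Normal]
    (h1 : ⁅⁅H₂, H₃⁆, H₁⁆ ≤ N) (h2 : ⁅⁅H₃, H₁⁆, H₂⁆ ≤ N) : ⁅⁅H₁, H₂⁆, H₃⁆ ≤ N := by
  have key : ∀ H : Subgroup G, H ≤ N ↔ H.map (QuotientGroup.mk' N) = ⊥ := by
    intro H
    rw [Subgroup.map_eq_bot_iff, QuotientGroup.ker_mk']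
  rw [key, Subgroup.map_commutator, Subgroup.map_commutator] at *
  exact Subgroup.commutator_commutator_eq_bot_of_rotate h1 h2

theorem gamma_one : gamma G 1 = ⊤ := rfl

theorem gamma_succ {i : ℕ} (hi : 1 ≤ i) : gamma G (i + 1) = ⁅gamma G i, ⊤⁆ := by
  obtain ⟨i, rfl⟩ := Nat.exists_eq_add_of_le' hi
  rfl

instance gamma_normal (i : ℕ) : (gamma G i).Normal := by
  unfold gamma; infer_instance

theorem gamma_antitone : Antitone (gamma G) := fun _ _ h =>
  Subgroup.lowerCentralSeries_antitone (S := ⊤) (Nat.sub_le_sub_right h 1)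

theorem isFiltration_gamma : IsFiltration (gamma G) := by
  refine ⟨fun i => gamma_antitone (Nat.le_succ i), fun i j => ?_⟩
  induction j generalizing i with
  | zero => exact Subgroup.commutator_le_left _ _
  | succ j ih =>
    -- Index 0 is separate: truncated subtraction makes `gamma G 0` and `gamma G 1` both `⊤`, so the
    -- recursion starts at 1.
    rcases Nat.eq_zero_or_pos i with rfl | hi
    · rw [zero_add]; exact Subgroup.commutator_le_right _ _
    rcases Nat.eq_zero_or_pos j with rfl | hj
    · rw [zero_add, gamma_one, gamma_succ hi]
    rw [gamma_succ hj, Subgroup.commutator_comm]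
    apply commutator_commutator_le_of_rotate
    · rw [Subgroup.commutator_comm ⊤, ← gamma_succ hi]
      exact (ih (i + 1)).trans (gamma_antitone (by omega))
    · rw [← add_assoc, gamma_succ (by omega : 1 ≤ i + j)]
      exact Subgroup.commutator_mono (ih i) le_rfl

theorem gamma_eq_bot [Group.IsNilpotent G] {c i : ℕ} (hc : Group.nilpotencyClass G = c)
    (hi : c + 1 ≤ i) : gamma G i = ⊥ := by
  unfold gamma
  rw [Subgroup.lowerCentralSeries_eq_bot_iff_nilpotencyClass_le]
  omega

end gamma

/-! ### Divisibility of binomial coefficients by powers of `p`. -/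

section choose

theorem prime_pow_dvd_mul_choose (p e : ℕ) (j : ℕ) (hj : 1 ≤ j) :
    p ^ e ∣ j * (p ^ e).choose j := by
  obtain ⟨j, rfl⟩ := Nat.exists_eq_add_of_le' hj
  rcases h : p ^ e with _ | n
  · simp
  · exact ⟨n.choose j, by rw [Nat.add_one_mul_choose_eq, mul_comm]⟩

theorem prime_pow_dvd_choose {p : ℕ} (hp : p.Prime) (e : ℕ) {j : ℕ} (hj : 1 ≤ j) (h : ¬ p ∣ j) :
    p ^ e ∣ (p ^ e).choose j :=
  (Nat.Coprime.pow_left e ((Nat.Prime.coprime_iff_not_dvd hp).2 h)).dvd_of_dvd_mul_left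
    (prime_pow_dvd_mul_choose p e j hj)

/-- Here `p ^ e` divides `q * (s * C)`, where `C` is the binomial coefficient, and `q` absorbs at
most one factor `p`. The multiplier `s` is there for `j = 9`, with `s = q = 3`. -/
theorem prime_pow_pred_dvd_mul_choose {p : ℕ} (hp : p.Prime) (e : ℕ) {j s : ℕ} (hj : 1 ≤ j)
    (h : ∃ q, j ∣ s * q ∧ ¬ p ^ 2 ∣ q) : p ^ (e - 1) ∣ s * (p ^ e).choose j := by
  obtain ⟨q, hq, hpq⟩ := h
  have h1 : p ^ e ∣ q * (s * (p ^ e).choose j) := by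
    refine (prime_pow_dvd_mul_choose p e j hj).trans ?_
    rw [← mul_assoc, mul_comm q]
    exact mul_dvd_mul_right hq _
  rcases e with _ | e
  · simp
  rw [Nat.add_sub_cancel]
  by_cases hpd : p ∣ q
  · obtain ⟨q', rfl⟩ := hpd
    generalize (p ^ (e + 1)).choose j = C at h1 ⊢
    rw [pow_succ', mul_assoc] at h1
    refine (Nat.Coprime.pow_left e ((Nat.Prime.coprime_iff_not_dvd hp).2 ?_)).dvd_of_dvd_mul_left
      (Nat.dvd_of_mul_dvd_mul_left hp.pos h1)
    rintro ⟨t, rfl⟩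
    exact hpq ⟨t, by ring⟩
  · exact (Nat.Coprime.pow_left e ((Nat.Prime.coprime_iff_not_dvd hp).2 hpd)).dvd_of_dvd_mul_left
      ((pow_dvd_pow p (Nat.le_succ e)).trans h1)

theorem prime_pow_pred_dvd_choose {p : ℕ} (hp : p.Prime) (e : ℕ) {j : ℕ} (hj : 1 ≤ j)
    (h : ¬ p ^ 2 ∣ j) : p ^ (e - 1) ∣ (p ^ e).choose j := by
  simpa using prime_pow_pred_dvd_mul_choose hp e (s := 1) hj ⟨j, by simp, h⟩

end choose

/-! ### Checking commutator inclusions on generators. -/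

section commutator

variable {G : Type*} [Group G]

/-- As a containment of `H` in a fixed subgroup, the condition can be tested on generators of `H`.
-/
theorem commutator_le_iff_le_comap_centralizer {H K N : Subgroup G} [N.Normal] :
    ⁅H, K⁆ ≤ N ↔ H ≤ (Subgroup.centralizer
      (K.map (QuotientGroup.mk' N) : Set (G ⧸ N))).comap (QuotientGroup.mk' N) := by
  rw [← Subgroup.map_le_iff_le_comap, ← Subgroup.commutator_eq_bot_iff_le_centralizer,
    ← Subgroup.map_commutator, Subgroup.map_eq_bot_iff, QuotientGroup.ker_mk']

theorem commutator_sup_le {H₁ H₂ K N : Subgroup G} [N.Normal] (h1 : ⁅H₁, K⁆ ≤ N)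
    (h2 : ⁅H₂, K⁆ ≤ N) : ⁅H₁ ⊔ H₂, K⁆ ≤ N := by
  rw [commutator_le_iff_le_comap_centralizer] at *
  exact sup_le h1 h2

theorem commutator_sup_sup_le {H₁ H₂ K₁ K₂ N : Subgroup G} [N.Normal] (h11 : ⁅H₁, K₁⁆ ≤ N)
    (h12 : ⁅H₁, K₂⁆ ≤ N) (h21 : ⁅H₂, K₁⁆ ≤ N) (h22 : ⁅H₂, K₂⁆ ≤ N) :
    ⁅H₁ ⊔ H₂, K₁ ⊔ K₂⁆ ≤ N := by
  apply commutator_sup_le <;> rw [Subgroup.commutator_comm] <;> apply commutator_sup_le <;>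
    rwa [Subgroup.commutator_comm]

theorem commutator_zpowers_zpowers_le {x y : G} {N : Subgroup G} [N.Normal] (h : ⁅x, y⁆ ∈ N) :
    ⁅Subgroup.zpowers x, Subgroup.zpowers y⁆ ≤ N := by
  rw [commutator_le_iff_le_comap_centralizer, Subgroup.zpowers_le, Subgroup.mem_comap,
    Subgroup.mem_centralizer_iff]
  rintro _ ⟨_, ⟨n, rfl⟩, rfl⟩
  rw [← QuotientGroup.ker_mk' N, MonoidHom.mem_ker, map_commutatorElement,
    commutatorElement_eq_one_iff_commute] at h
  simp only [map_zpow]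
  exact (h.symm.zpow_left n).eq

theorem commutator_zpowers_le {x : G} {K N : Subgroup G} [N.Normal] (h : ∀ t ∈ K, ⁅x, t⁆ ∈ N) :
    ⁅Subgroup.zpowers x, K⁆ ≤ N :=
  Subgroup.commutator_le.2 fun _ hg t ht => commutator_zpowers_zpowers_le (h t ht)
    (Subgroup.commutator_mem_commutator hg (Subgroup.mem_zpowers t))

theorem commutator_zpowers_sup_le {x : G} {H N : Subgroup G} [N.Normal] (h : ∀ t ∈ H, ⁅x, t⁆ ∈ N)
    (hH : ⁅H, H⁆ ≤ N) : ⁅Subgroup.zpowers x ⊔ H, Subgroup.zpowers x ⊔ H⁆ ≤ N := by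
  have h1 := commutator_zpowers_le h
  refine commutator_sup_sup_le (commutator_zpowers_zpowers_le ?_) h1 ?_ hH
  · rw [commutatorElement_self]; exact one_mem N
  · rwa [Subgroup.commutator_comm]

theorem commutator_normalClosure_le {S : Set G} {K N : Subgroup G} [K.Normal] [N.Normal]
    (h : ∀ s ∈ S, ∀ t ∈ K, ⁅s, t⁆ ∈ N) : ⁅Subgroup.normalClosure S, K⁆ ≤ N := by
  have : (K.map (QuotientGroup.mk' N)).Normal :=
    Subgroup.Normal.map inferInstance _ (QuotientGroup.mk'_surjective N)
  rw [commutator_le_iff_le_comap_centralizer]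
  refine Subgroup.normalClosure_le_normal fun s hs => ?_
  rw [SetLike.mem_coe, ← Subgroup.zpowers_le, ← commutator_le_iff_le_comap_centralizer]
  exact commutator_zpowers_le (h s hs)

end commutator

/-! ### Subgroups generated by lower central terms and cubes. -/

/-- The normal closure of the cubes of the elements of `γ_b(G)`. -/
def gammaCubes (G : Type*) [Group G] (b : ℕ) : Subgroup G :=
  Subgroup.normalClosure ((· ^ 3) '' (gamma G b : Set G))

/-- The product of `γ_a(G)` and of the subgroup generated by the cubes of `γ_b(G)`. -/
def gammaSupCubes (G : Type*) [Group G] (a b : ℕ) : Subgroup G :=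
  gamma G a ⊔ gammaCubes G b

section gammaCubes

variable {G : Type*} [Group G]

instance (b : ℕ) : (gammaCubes G b).Normal := by unfold gammaCubes; infer_instance

instance (a b : ℕ) : (gammaSupCubes G a b).Normal := by unfold gammaSupCubes; infer_instance

theorem gammaCubes_le_gamma (b : ℕ) : gammaCubes G b ≤ gamma G b := by
  apply Subgroup.normalClosure_le_normal
  rintro _ ⟨h, hh, rfl⟩
  exact pow_mem hh 3

theorem gammaCubes_antitone : Antitone (gammaCubes G) := fun _ _ h =>
  Subgroup.normalClosure_mono (Set.image_mono (gamma_antitone h))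

theorem pow_three_mem_gammaCubes {b : ℕ} {h : G} (hh : h ∈ gamma G b) : h ^ 3 ∈ gammaCubes G b :=
  Subgroup.subset_normalClosure ⟨h, hh, rfl⟩

theorem gammaSupCubes_mono {a b a' b' : ℕ} (ha : a' ≤ a) (hb : b' ≤ b) :
    gammaSupCubes G a b ≤ gammaSupCubes G a' b' :=
  sup_le_sup (gamma_antitone ha) (gammaCubes_antitone hb)

theorem gamma_le_gammaSupCubes (a b : ℕ) : gamma G a ≤ gammaSupCubes G a b := le_sup_left

theorem gammaCubes_le_gammaSupCubes (a b : ℕ) : gammaCubes G b ≤ gammaSupCubes G a b := le_sup_right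

theorem gammaSupCubes_le_gamma {a b m : ℕ} (ha : m ≤ a) (hb : m ≤ b) :
    gammaSupCubes G a b ≤ gamma G m :=
  sup_le (gamma_antitone ha) ((gammaCubes_le_gamma b).trans (gamma_antitone hb))

theorem commutator_pow_three {h t : G} (hc : Commute h ⁅h, t⁆) : ⁅h ^ 3, t⁆ = ⁅h, t⁆ ^ 3 := by
  have h1 : t * h * t⁻¹ = ⁅h, t⁆⁻¹ * h := by rw [commutatorElement_def]; group
  have h2 : t * h ^ 3 * t⁻¹ = (⁅h, t⁆ ^ 3)⁻¹ * h ^ 3 := by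
    rw [← conj_pow, h1, hc.symm.inv_left.mul_pow, inv_pow]
  have h3 : ⁅h ^ 3, t⁆ = h ^ 3 * (t * h ^ 3 * t⁻¹)⁻¹ := by rw [commutatorElement_def]; group
  rw [h3, h2]; group

theorem mem_gamma_one (x : G) : x ∈ gamma G 1 := Subgroup.mem_top x

theorem gamma_eq_bot_of_le {m i : ℕ} (hm : gamma G m = ⊥) (h : m ≤ i) : gamma G i = ⊥ :=
  le_bot_iff.1 ((gamma_antitone h).trans hm.le)

/-- The weight bound forces `⁅h, ⁅h, t⁆⁆ = 1`, so `⁅h ^ 3, t⁆ = ⁅h, t⁆ ^ 3`. -/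
theorem commutator_gammaCubes_le (h7 : gamma G 7 = ⊥) {a b : ℕ} (hab : 7 ≤ a + 2 * b) :
    ⁅gammaCubes G b, gamma G a⁆ ≤ gammaCubes G (a + b) := by
  apply commutator_normalClosure_le
  rintro _ ⟨h, hh, rfl⟩ t ht
  have hw : ⁅h, t⁆ ∈ gamma G (a + b) :=
    isFiltration_gamma.commutator_mem hh ht (Nat.add_comm a b).le
  have hc : ⁅h, ⁅h, t⁆⁆ ∈ gamma G 7 := isFiltration_gamma.commutator_mem hh hw (by omega)
  rw [h7, Subgroup.mem_bot, commutatorElement_eq_one_iff_commute] at hc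
  simp only
  rw [commutator_pow_three hc]
  exact pow_three_mem_gammaCubes hw

theorem commutator_gammaSupCubes_le (h7 : gamma G 7 = ⊥) {a b a' b' A B : ℕ}
    (h1 : 7 ≤ a' + 2 * b) (h2 : 7 ≤ a + 2 * b') (h3 : 7 ≤ b' + 2 * b) (hA : A ≤ a + a')
    (hB : B ≤ a + b') (hB' : B ≤ a' + b) (hB'' : B ≤ b + b') :
    ⁅gammaSupCubes G a b, gammaSupCubes G a' b'⁆ ≤ gammaSupCubes G A B := by
  refine commutator_sup_sup_le ?_ ?_ ?_ ?_
  · exact ((isFiltration_gamma.commutator_le _ _).trans (gamma_antitone hA)).trans le_sup_left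
  · rw [Subgroup.commutator_comm]
    exact ((commutator_gammaCubes_le h7 h2).trans (gammaCubes_antitone hB)).trans le_sup_right
  · exact ((commutator_gammaCubes_le h7 h1).trans (gammaCubes_antitone hB')).trans le_sup_right
  · exact (((Subgroup.commutator_mono le_rfl (gammaCubes_le_gamma b')).trans
      (commutator_gammaCubes_le h7 h3)).trans
        (gammaCubes_antitone (by omega))).trans le_sup_right

end gammaCubes

/-! ### The filtration for class at most 6. -/

section classSix

variable {G : Type*} [Group G]

/-- The fourth term of `sixFiltration`. -/
def sixFour (x c : G) : Subgroup G := Subgroup.zpowers ⁅c, x⁆ ⊔ gammaSupCubes G 4 3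

/-- The third term of `sixFiltration`. -/
def sixThree (x c : G) : Subgroup G := Subgroup.zpowers c ⊔ sixFour x c

/-- The first term of `sixFiltration`. -/
def sixOne (x c : G) : Subgroup G := Subgroup.zpowers x ⊔ sixThree x c

/-- The seventh term of `sixFiltration`. -/
def sixSeven (x c : G) : Subgroup G := Subgroup.zpowers ⁅c, ⁅c, x⁆⁆ ⊔ gammaSupCubes G 6 4

/-- A filtration adapted to the sequence of conjugates of `x` by powers with triangular exponents
in a group of class at most `6`, where `c` is the first Taylor coefficient of the conjugates. -/
def sixFiltration (x c : G) : ℕ → Subgroup G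
  | 0 => sixOne x c
  | 1 => sixOne x c
  | 2 => sixThree x c
  | 3 => sixThree x c
  | 4 => sixFour x c
  | 5 => gammaSupCubes G 4 3
  | 6 => gammaSupCubes G 5 4
  | 7 => sixSeven x c
  | 8 => gammaSupCubes G 6 5
  | 9 => gammaSupCubes G 7 5
  | 10 => gammaSupCubes G 7 6
  | 11 => gammaSupCubes G 7 6
  | _ => ⊥

theorem gammaSupCubes_eq_bot (h7 : gamma G 7 = ⊥) {a b : ℕ} (ha : 7 ≤ a) (hb : 7 ≤ b) :
    gammaSupCubes G a b = ⊥ :=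
  le_bot_iff.1 ((gammaSupCubes_le_gamma ha hb).trans h7.le)

theorem sixFour_le_gamma {x c : G} (hc : c ∈ gamma G 2) : sixFour x c ≤ gamma G 3 :=
  sup_le ((Subgroup.zpowers_le).2 (isFiltration_gamma.commutator_mem hc (mem_gamma_one x) le_rfl))
    (gammaSupCubes_le_gamma (by omega) le_rfl)

theorem sixThree_le_gamma {x c : G} (hc : c ∈ gamma G 2) : sixThree x c ≤ gamma G 2 :=
  sup_le ((Subgroup.zpowers_le).2 hc) ((sixFour_le_gamma hc).trans (gamma_antitone (by omega)))

theorem sixSeven_le {x c : G} (hc : c ∈ gamma G 2) : sixSeven x c ≤ gammaSupCubes G 5 4 := by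
  refine sup_le ((Subgroup.zpowers_le).2 (gamma_le_gammaSupCubes 5 4 ?_))
    (gammaSupCubes_mono (by omega) le_rfl)
  exact isFiltration_gamma.commutator_mem hc (isFiltration_gamma.commutator_mem hc
    (mem_gamma_one x) le_rfl) le_rfl

theorem sixFour_normal {x c : G} (hc : c ∈ gamma G 2) : (sixFour x c).Normal := by
  rw [← Subgroup.commutator_top_right_le_iff]
  exact ((Subgroup.commutator_mono (sixFour_le_gamma hc) (le_refl (gamma G 1))).trans
    ((isFiltration_gamma.commutator_le 3 1).trans (gamma_le_gammaSupCubes 4 3))).trans le_sup_right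

theorem sixSeven_normal (h7 : gamma G 7 = ⊥) {x c : G} (hc : c ∈ gamma G 2) :
    (sixSeven x c).Normal := by
  rw [← Subgroup.commutator_top_right_le_iff]
  refine (Subgroup.commutator_mono (sixSeven_le hc) (gamma_le_gammaSupCubes 1 3)).trans
    ((commutator_gammaSupCubes_le (A := 6) (B := 4) h7 ?_ ?_ ?_ ?_ ?_ ?_ ?_).trans le_sup_right)
  all_goals omega

/-- Since `c` commutes with itself, `⁅c, ⁅c, x⁆⁆` is the only new generator needed beyond `γ_6` and
cubes of `γ_4`. This is the gain from using `⟨c⟩` rather than all of `γ_2`. -/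
theorem commutator_sixThree_le (h7 : gamma G 7 = ⊥) {x c : G} (hc : c ∈ gamma G 2) :
    ⁅sixThree x c, sixThree x c⁆ ≤ sixSeven x c := by
  have := sixSeven_normal (x := x) h7 hc
  have h66 : gamma G 6 ≤ sixSeven x c := (gamma_le_gammaSupCubes 6 4).trans le_sup_right
  refine commutator_zpowers_sup_le ?_ ?_
  · intro t ht
    refine commutator_zpowers_le (x := c) (K := sixFour x c) (fun t ht => ?_)
      (Subgroup.commutator_mem_commutator (Subgroup.mem_zpowers c) ht)
    have key : ⁅sixFour x c, Subgroup.zpowers c⁆ ≤ sixSeven x c := by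
      refine commutator_sup_le ?_ ?_
      · rw [Subgroup.commutator_comm]
        exact commutator_zpowers_zpowers_le
          (le_sup_left (α := Subgroup G) (Subgroup.mem_zpowers _))
      · refine (Subgroup.commutator_mono le_rfl (((Subgroup.zpowers_le).2 hc).trans
          (gamma_le_gammaSupCubes 2 3))).trans
            ((commutator_gammaSupCubes_le (A := 6) (B := 4) h7 ?_ ?_ ?_ ?_ ?_ ?_ ?_).trans
              le_sup_right)
        all_goals omega
    rw [Subgroup.commutator_comm] at key
    exact key (Subgroup.commutator_mem_commutator (Subgroup.mem_zpowers c) ht)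
  · exact ((Subgroup.commutator_mono (sixFour_le_gamma hc) (sixFour_le_gamma hc)).trans
      (isFiltration_gamma.commutator_le 3 3)).trans h66

theorem sixSeven_le_sixFour {x c : G} (hc : c ∈ gamma G 2) : sixSeven x c ≤ sixFour x c :=
  ((sixSeven_le hc).trans (gammaSupCubes_mono (by omega) (by omega))).trans le_sup_right

theorem commutator_sixOne_le (h7 : gamma G 7 = ⊥) {x c : G} (hc : c ∈ gamma G 2) :
    ⁅sixOne x c, sixOne x c⁆ ≤ sixFour x c := by
  have := sixFour_normal (x := x) hc
  have h4 : gamma G 4 ≤ sixFour x c := (gamma_le_gammaSupCubes 4 3).trans le_sup_right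
  have key : ⁅sixThree x c, Subgroup.zpowers x⁆ ≤ sixFour x c := by
    refine commutator_sup_le ?_ ?_
    · exact commutator_zpowers_zpowers_le (le_sup_left (α := Subgroup G) (Subgroup.mem_zpowers _))
    · exact (Subgroup.commutator_mono (sixFour_le_gamma hc) (le_top : _ ≤ gamma G 1)).trans
        ((isFiltration_gamma.commutator_le 3 1).trans h4)
  rw [Subgroup.commutator_comm] at key
  refine commutator_zpowers_sup_le (fun t ht => ?_) ?_
  · exact key (Subgroup.commutator_mem_commutator (Subgroup.mem_zpowers x) ht)
  · exact (commutator_sixThree_le h7 hc).trans (sixSeven_le_sixFour hc)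

/-- The term of `sixFiltration` with index `i` is contained in `gammaSupCubes G a b`, where
`(a, b)` is the value at `i`. -/
def sixUpper (i : ℕ) : ℕ × ℕ :=
  [(1, 3), (1, 3), (2, 3), (2, 3), (3, 3), (4, 3), (5, 4), (5, 4), (6, 5), (7, 5), (7, 6),
    (7, 6)].getD i (7, 7)

/-- The term of `sixFiltration` with index `i ≥ 4` contains `gammaSupCubes G a b`, where `(a, b)` is
the value at `i`. -/
def sixLower (i : ℕ) : ℕ × ℕ :=
  [(1, 3), (1, 3), (2, 3), (2, 3), (4, 3), (4, 3), (5, 4), (6, 4), (6, 5), (7, 5), (7, 6),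
    (7, 6)].getD i (7, 7)

theorem le_sixUpper : ∀ i < 12, 1 ≤ (sixUpper i).1 ∧ 3 ≤ (sixUpper i).2 := by decide

set_option maxRecDepth 4000 in
set_option synthInstance.maxSize 512 in
-- A finite check of the weight inequalities of `commutator_gammaSupCubes_le`. The excluded pairs
-- are those covered by `commutator_sixThree_le` and `commutator_sixOne_le`; the default `(7, 7)`
-- stands for the trivial group.
theorem sixLower_add_le : ∀ i < 12, ∀ j < 12, ¬ (2 ≤ i ∧ 2 ≤ j ∧ i + j ≤ 7) → ¬ i + j ≤ 4 →
    (sixLower (i + j)).1 ≤ (sixUpper i).1 + (sixUpper j).1 ∧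
    (sixLower (i + j)).2 ≤ (sixUpper i).1 + (sixUpper j).2 ∧
    (sixLower (i + j)).2 ≤ (sixUpper j).1 + (sixUpper i).2 ∧
    (sixLower (i + j)).2 ≤ (sixUpper i).2 + (sixUpper j).2 := by
  decide

theorem sixFiltration_of_le {x c : G} {i : ℕ} (hi : 12 ≤ i) : sixFiltration x c i = ⊥ := by
  obtain ⟨i, rfl⟩ := Nat.exists_eq_add_of_le' hi
  rfl

theorem sixFiltration_le {x c : G} (hc : c ∈ gamma G 2) (i : ℕ) :
    sixFiltration x c i ≤ gammaSupCubes G (sixUpper i).1 (sixUpper i).2 := by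
  rcases le_or_gt 12 i with h | h
  · rw [sixFiltration_of_le h]; exact bot_le
  have h1 : sixOne x c ≤ gammaSupCubes G 1 3 := (le_top : _ ≤ gamma G 1).trans le_sup_left
  have h3 := (sixThree_le_gamma (x := x) hc).trans (gamma_le_gammaSupCubes 2 3)
  have h4 := (sixFour_le_gamma (x := x) hc).trans (gamma_le_gammaSupCubes 3 3)
  have h7 := sixSeven_le (x := x) hc
  interval_cases i
  exacts [h1, h1, h3, h3, h4, le_rfl, le_rfl, h7, le_rfl, le_rfl, le_rfl, le_rfl]

theorem le_sixFiltration (h7 : gamma G 7 = ⊥) (x c : G) {i : ℕ} (hi : 4 ≤ i) :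
    gammaSupCubes G (sixLower i).1 (sixLower i).2 ≤ sixFiltration x c i := by
  rcases le_or_gt 12 i with h | h
  · obtain ⟨i, rfl⟩ := Nat.exists_eq_add_of_le' h
    exact (gammaSupCubes_eq_bot h7 le_rfl le_rfl).le
  interval_cases i
  exacts [le_sup_right, le_rfl, le_rfl, le_sup_right, le_rfl, le_rfl, le_rfl, le_rfl]

theorem isFiltration_sixFiltration (h7 : gamma G 7 = ⊥) {x c : G} (hc : c ∈ gamma G 2) :
    IsFiltration (sixFiltration x c) := by
  have hanti : ∀ i, sixFiltration x c (i + 1) ≤ sixFiltration x c i := by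
    intro i
    rcases le_or_gt 11 i with h | h
    · rw [sixFiltration_of_le (by omega)]; exact bot_le
    interval_cases i
    · exact le_rfl
    · exact le_sup_right
    · exact le_rfl
    · exact le_sup_right
    · exact le_sup_right
    · exact gammaSupCubes_mono (by omega) (by omega)
    · exact sixSeven_le hc
    · exact (gammaSupCubes_mono le_rfl (by omega)).trans le_sup_right
    · exact gammaSupCubes_mono (by omega) (by omega)
    · exact gammaSupCubes_mono (by omega) (by omega)
    · exact le_rfl
  refine ⟨hanti, fun i j => ?_⟩
  have hmono := antitone_nat_of_succ_le hanti
  rcases le_or_gt 12 i with hi | hi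
  · rw [sixFiltration_of_le hi, Subgroup.commutator_bot_left]; exact bot_le
  rcases le_or_gt 12 j with hj | hj
  · rw [sixFiltration_of_le hj, Subgroup.commutator_bot_right]; exact bot_le
  by_cases h3 : 2 ≤ i ∧ 2 ≤ j ∧ i + j ≤ 7
  · exact ((Subgroup.commutator_mono (hmono h3.1) (hmono h3.2.1)).trans
      (commutator_sixThree_le h7 hc)).trans (hmono h3.2.2)
  by_cases h1 : i + j ≤ 4
  · exact ((Subgroup.commutator_mono (hmono (Nat.zero_le i)) (hmono (Nat.zero_le j))).trans
      (commutator_sixOne_le h7 hc)).trans (hmono h1)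
  · obtain ⟨k1, k2, k3, k4⟩ := sixLower_add_le i hi j hj h3 h1
    obtain ⟨a1, a2⟩ := le_sixUpper i hi
    obtain ⟨b1, b2⟩ := le_sixUpper j hj
    exact ((Subgroup.commutator_mono (sixFiltration_le hc i) (sixFiltration_le hc j)).trans
      (commutator_gammaSupCubes_le h7 (by omega) (by omega) (by omega) k1 k2 k3 k4)).trans
        (le_sixFiltration h7 x c (by omega))

end classSix

/-! ### Binomial coefficients of triangular numbers. -/

section triangular

theorem cast_choose_succ_two (i : ℕ) : ((i + 1).choose 2 : ℚ) = (i + 1) * i / 2 := by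
  rw [Nat.cast_choose_two]; push_cast; ring

/-- In this and the next three identities every coefficient is a multiple of 3, except that of `(i +
2).choose 4` in `triangular_choose_three`. Hence only cubes appear in high degree. -/
theorem triangular_choose_two (i : ℕ) : ((i + 1).choose 2).choose 2 = 3 * (i + 2).choose 4 := by
  apply Nat.cast_injective (R := ℚ)
  push_cast
  rw [Nat.cast_choose_eq_descPochhammer_div ℚ _ 2, Nat.cast_choose_eq_descPochhammer_div ℚ _ 4,
    cast_choose_succ_two]
  simp only [descPochhammer_succ_eval, descPochhammer_zero, Polynomial.eval_one, Nat.factorial]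
  push_cast
  ring

theorem triangular_choose_three (i : ℕ) :
    ((i + 1).choose 2).choose 3 = 15 * (i + 3).choose 6 + (i + 2).choose 4 := by
  apply Nat.cast_injective (R := ℚ)
  push_cast
  rw [Nat.cast_choose_eq_descPochhammer_div ℚ _ 3, Nat.cast_choose_eq_descPochhammer_div ℚ _ 4,
    Nat.cast_choose_eq_descPochhammer_div ℚ _ 6, cast_choose_succ_two]
  simp only [descPochhammer_succ_eval, descPochhammer_zero, Polynomial.eval_one, Nat.factorial]
  push_cast
  ring

theorem triangular_choose_four (i : ℕ) :
    ((i + 1).choose 2).choose 4 = 105 * (i + 4).choose 8 + 15 * (i + 3).choose 6 := by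
  apply Nat.cast_injective (R := ℚ)
  push_cast
  rw [Nat.cast_choose_eq_descPochhammer_div ℚ _ 4, Nat.cast_choose_eq_descPochhammer_div ℚ _ 6,
    Nat.cast_choose_eq_descPochhammer_div ℚ _ 8, cast_choose_succ_two]
  simp only [descPochhammer_succ_eval, descPochhammer_zero, Polynomial.eval_one, Nat.factorial]
  push_cast
  ring

theorem triangular_choose_five (i : ℕ) : ((i + 1).choose 2).choose 5 =
    945 * (i + 5).choose 10 + 210 * (i + 4).choose 8 + 6 * (i + 3).choose 6 := by
  apply Nat.cast_injective (R := ℚ)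
  push_cast
  rw [Nat.cast_choose_eq_descPochhammer_div ℚ _ 5, Nat.cast_choose_eq_descPochhammer_div ℚ _ 6,
    Nat.cast_choose_eq_descPochhammer_div ℚ _ 8, Nat.cast_choose_eq_descPochhammer_div ℚ _ 10,
    cast_choose_succ_two]
  simp only [descPochhammer_succ_eval, descPochhammer_zero, Polynomial.eval_one, Nat.factorial]
  push_cast
  ring

end triangular

/-! ### Taylor expansion of the conjugates when `d = 1`. -/

section conjugates

variable {G : Type*} [Group G] {F : ℕ → Subgroup G}

theorem pow_choose_add_mem_polySeq (hF : IsFiltration F) {i j : ℕ} {a : G} (ha : a ∈ F (i + j))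
    (s : ℕ) : (fun n : ℕ => a ^ (n + s).choose j) ∈ polySeq F hF i :=
  shift_mem_polySeq hF (pow_choose_mem_polySeq hF ha) s

theorem conj_pow_mem_polySeq (k x : G) :
    (fun n : ℕ => (k ^ n)⁻¹ * x * k ^ n) ∈ polySeq (gamma G) isFiltration_gamma 1 := by
  have hk : (fun n : ℕ => k ^ n) ∈ polySeq (gamma G) isFiltration_gamma 0 := by
    simpa using pow_choose_mem_polySeq isFiltration_gamma (i := 0) (j := 1) (mem_gamma_one k)
  exact (isFiltration_polySeq isFiltration_gamma).conj_mem' hk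
    (const_mem_polySeq isFiltration_gamma (mem_gamma_one x))

theorem exists_conj_pow_eq_taylorProd (h7 : gamma G 7 = ⊥) (k x : G) :
    ∃ c : ℕ → G, c 0 = x ∧ (∀ j < 6, c j ∈ gamma G (1 + j)) ∧
      ∀ n : ℕ, (k ^ n)⁻¹ * x * k ^ n = taylorProd c 6 n := by
  obtain ⟨c, hc, h⟩ := exists_taylor_of_eq_bot isFiltration_gamma (s := 6) h7
    (conj_pow_mem_polySeq k x)
  refine ⟨c, ?_, hc, fun n => congrFun h n⟩
  have := congrFun h 0
  simpa [taylorProd, List.range_succ] using this.symm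

/-- Substitute a triangular number into the Taylor expansion of `k ^ (-n) * x * k ^ n`: degrees
double, and the coefficients divisible by 3 place cubes in the deep terms. -/
theorem conj_triangular_mem_polySeq (h7 : gamma G 7 = ⊥) (k x : G) :
    ∃ c, ∃ hc : c ∈ gamma G 2,
      (fun m : ℕ => (k ^ (m + 1).choose 2)⁻¹ * x * k ^ (m + 1).choose 2) ∈
        polySeq (sixFiltration x c) (isFiltration_sixFiltration h7 hc) 1 := by
  obtain ⟨c, rfl, hc, h⟩ := exists_conj_pow_eq_taylorProd h7 k x
  refine ⟨c 1, hc 1 (by omega), ?_⟩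
  have hF := isFiltration_sixFiltration (x := c 0) h7 (hc 1 (by omega))
  have m0 : c 0 ∈ sixFiltration (c 0) (c 1) (1 + 0) :=
    le_sup_left (α := Subgroup G) (Subgroup.mem_zpowers _)
  have m1 : c 1 ∈ sixFiltration (c 0) (c 1) (1 + 2) :=
    le_sup_left (α := Subgroup G) (Subgroup.mem_zpowers _)
  have m2 : c 2 ^ 3 ∈ sixFiltration (c 0) (c 1) (1 + 4) :=
    gammaCubes_le_gammaSupCubes 4 3 (pow_three_mem_gammaCubes (hc 2 (by omega)))
  have m3 : c 3 ∈ sixFiltration (c 0) (c 1) (1 + 4) :=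
    gamma_le_gammaSupCubes 4 3 (hc 3 (by omega))
  have m3' : c 3 ^ 3 ∈ sixFiltration (c 0) (c 1) (1 + 6) := le_sup_right (α := Subgroup G)
    (gammaCubes_le_gammaSupCubes 6 4 (pow_three_mem_gammaCubes (hc 3 (by omega))))
  have m4 : c 4 ^ 3 ∈ sixFiltration (c 0) (c 1) (1 + 8) :=
    gammaCubes_le_gammaSupCubes 7 5 (pow_three_mem_gammaCubes (hc 4 (by omega)))
  have m5 : c 5 ^ 3 ∈ sixFiltration (c 0) (c 1) (1 + 10) :=
    gammaCubes_le_gammaSupCubes 7 6 (pow_three_mem_gammaCubes (hc 5 (by omega)))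
  have m4' := hF.antitone (by omega : 1 + 6 ≤ 1 + 8) m4
  have m5' := hF.antitone (by omega : 1 + 8 ≤ 1 + 10) m5
  have m5'' := hF.antitone (by omega : 1 + 6 ≤ 1 + 10) m5
  have e : (fun m : ℕ => (k ^ (m + 1).choose 2)⁻¹ * c 0 * k ^ (m + 1).choose 2) =
      (fun _ => c 0) * (fun m => c 1 ^ (m + 1).choose 2) *
      (fun m => (c 2 ^ 3) ^ (m + 2).choose 4) *
      ((fun m => ((c 3 ^ 3) ^ 5) ^ (m + 3).choose 6) * (fun m => c 3 ^ (m + 2).choose 4)) *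
      ((fun m => ((c 4 ^ 3) ^ 35) ^ (m + 4).choose 8) *
        (fun m => ((c 4 ^ 3) ^ 5) ^ (m + 3).choose 6)) *
      ((fun m => ((c 5 ^ 3) ^ 315) ^ (m + 5).choose 10) *
        (fun m => ((c 5 ^ 3) ^ 70) ^ (m + 4).choose 8) *
        (fun m => ((c 5 ^ 3) ^ 2) ^ (m + 3).choose 6)) := by
    funext m
    rw [h]
    simp only [Pi.mul_apply, ← pow_mul, ← pow_add]
    simp [taylorProd, List.range_succ, triangular_choose_two, triangular_choose_three,
      triangular_choose_four, triangular_choose_five, mul_assoc]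
  rw [e]
  refine mul_mem (mul_mem (mul_mem (mul_mem (mul_mem ?_ ?_) ?_) (mul_mem ?_ ?_)) (mul_mem ?_ ?_))
    (mul_mem (mul_mem ?_ ?_) ?_)
  · exact const_mem_polySeq hF m0
  · exact pow_choose_add_mem_polySeq hF m1 1
  · exact pow_choose_add_mem_polySeq hF m2 2
  · exact pow_choose_add_mem_polySeq hF (pow_mem m3' 5) 3
  · exact pow_choose_add_mem_polySeq hF m3 2
  · exact pow_choose_add_mem_polySeq hF (pow_mem m4 35) 4
  · exact pow_choose_add_mem_polySeq hF (pow_mem m4' 5) 3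
  · exact pow_choose_add_mem_polySeq hF (pow_mem m5 315) 5
  · exact pow_choose_add_mem_polySeq hF (pow_mem m5' 70) 4
  · exact pow_choose_add_mem_polySeq hF (pow_mem m5'' 2) 3

end conjugates

/-! ### Killing the Taylor coefficients when `d = 1`. -/

section powers

variable {G : Type*} [Group G]

theorem pow_eq_one_of_dvd {a : G} {m n : ℕ} (h : a ^ m = 1) (hmn : m ∣ n) : a ^ n = 1 :=
  orderOf_dvd_iff_pow_eq_one.1 ((orderOf_dvd_of_pow_eq_one h).trans hmn)

/-- When `γ_b` is abelian, its elements killed by `m` form a normal subgroup, which contains the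
cubes. -/
theorem pow_eq_one_of_mem_gammaCubes {b m : ℕ}
    (hcomm : ∀ g ∈ gamma G b, ∀ h ∈ gamma G b, Commute g h)
    (hm : ∀ h ∈ gamma G b, h ^ (3 * m) = 1) {a : G} (ha : a ∈ gammaCubes G b) : a ^ m = 1 := by
  let N : Subgroup G :=
    { carrier := {a | a ∈ gamma G b ∧ a ^ m = 1}
      one_mem' := ⟨one_mem _, one_pow m⟩
      mul_mem' := fun {g h} hg hh =>
        ⟨mul_mem hg.1 hh.1, by rw [(hcomm g hg.1 h hh.1).mul_pow, hg.2, hh.2, one_mul]⟩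
      inv_mem' := fun {g} hg => ⟨inv_mem hg.1, by rw [inv_pow, hg.2, inv_one]⟩ }
  have hN : N.Normal := ⟨fun n hn g =>
    ⟨(gamma_normal b).conj_mem n hn.1 g, by rw [conj_pow, hn.2, mul_one, mul_inv_cancel]⟩⟩
  have hle : gammaCubes G b ≤ N := by
    apply Subgroup.normalClosure_le_normal
    rintro _ ⟨h, hh, rfl⟩
    exact ⟨pow_mem hh 3, by simp only; rw [← pow_mul, hm h hh]⟩
  exact (hle ha).2

theorem not_sq_dvd {p j : ℕ} (hp2 : 2 < p) (hj : 1 ≤ j) (hj9 : j ≠ 9) (hj16 : j < 16) :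
    ¬ p ^ 2 ∣ j := by
  intro h
  have hle := Nat.le_of_dvd hj h
  have hp4 : p < 4 := by nlinarith
  interval_cases p
  omega

theorem pow_choose_eq_one_of_mem_sixFiltration (h7 : gamma G 7 = ⊥) {p e : ℕ} (hp : p.Prime)
    (hp2 : 2 < p) (hexp : ∀ a : G, a ^ p ^ e = 1) (hexp2 : ∀ a ∈ gamma G 2, a ^ p ^ (e - 1) = 1)
    {x c : G} (hc : c ∈ gamma G 2) {j : ℕ} (hj : 1 ≤ j) {a : G} (ha : a ∈ sixFiltration x c j) :
    a ^ (p ^ e).choose j = 1 := by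
  have hF := isFiltration_sixFiltration (x := x) h7 hc
  rcases le_or_gt 12 j with h12 | h12
  · rw [sixFiltration_of_le h12, Subgroup.mem_bot] at ha
    rw [ha, one_pow]
  rcases hj.eq_or_lt with rfl | h2
  · rw [Nat.choose_one_right]; exact hexp a
  -- Only here can `p ^ 2 ∣ j`, for `p = 3`; as `γ_7` is trivial, this term is generated by cubes of
  -- `γ_5`, supplying the missing factor 3.
  by_cases h9 : j = 9
  · subst h9
    have ha5 : a ∈ gammaCubes G 5 := by
      have h : a ∈ gamma G 7 ⊔ gammaCubes G 5 := ha
      rwa [h7, bot_sup_eq] at h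
    refine pow_eq_one_of_mem_gammaCubes (fun g hg h hh => ?_) (fun h hh => ?_) ha5
    · have := isFiltration_gamma.commutator_mem hg hh (by omega : 7 ≤ 5 + 5)
      rwa [h7, Subgroup.mem_bot, commutatorElement_eq_one_iff_commute] at this
    · refine pow_eq_one_of_dvd (hexp2 h (gamma_antitone (by omega) hh))
        (prime_pow_pred_dvd_mul_choose hp e hj ⟨3, by norm_num, ?_⟩)
      exact not_sq_dvd hp2 (by norm_num) (by norm_num) (by norm_num)
  · exact pow_eq_one_of_dvd (hexp2 a (sixThree_le_gamma hc (hF.antitone h2 ha)))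
      (prime_pow_pred_dvd_choose hp e hj (not_sq_dvd hp2 hj h9 (by omega)))

end powers

/-! ### The case `d ≥ 2`. -/

section deep

variable {G : Type*} [Group G]

/-- A filtration adapted to `x` and the elements of `γ_d(G)` for `d ≥ 2`. -/
def deepFiltration (x : G) (d : ℕ) : ℕ → Subgroup G
  | 0 => Subgroup.zpowers x ⊔ gamma G d
  | 1 => Subgroup.zpowers x ⊔ gamma G d
  | m + 2 => gamma G (d + m)

/-- The bound on `d` enters through `2 * d + i + j ≥ d + (i + j + 2)`. -/
theorem isFiltration_deepFiltration (x : G) {d : ℕ} (hd : 2 ≤ d) :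
    IsFiltration (deepFiltration x d) := by
  have hanti : ∀ i, deepFiltration x d (i + 1) ≤ deepFiltration x d i
    | 0 => le_rfl
    | 1 => le_sup_right
    | i + 2 => gamma_antitone (by omega)
  have hmono := antitone_nat_of_succ_le hanti
  have h00 : ⁅deepFiltration x d 0, deepFiltration x d 0⁆ ≤ deepFiltration x d 3 := by
    refine commutator_zpowers_sup_le (N := gamma G (d + 1)) (fun t ht => ?_) ?_
    · exact isFiltration_gamma.commutator_mem (mem_gamma_one x) ht (by omega)
    · exact (isFiltration_gamma.commutator_le d d).trans (gamma_antitone (by omega))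
  have h0 : ∀ m, ⁅deepFiltration x d 0, deepFiltration x d (m + 2)⁆ ≤ deepFiltration x d (m + 3) :=
    fun m => (Subgroup.commutator_mono (le_top : _ ≤ gamma G 1) le_rfl).trans
      ((isFiltration_gamma.commutator_le 1 (d + m)).trans (gamma_antitone (by omega)))
  refine ⟨hanti, fun i j => ?_⟩
  by_cases hi : i ≤ 1
  · by_cases hj : j ≤ 1
    · exact ((Subgroup.commutator_mono (hmono (Nat.zero_le i)) (hmono (Nat.zero_le j))).trans
        h00).trans (hmono (by omega))
    · obtain ⟨j, rfl⟩ := Nat.exists_eq_add_of_le' (by omega : 2 ≤ j)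
      exact ((Subgroup.commutator_mono (hmono (Nat.zero_le i)) le_rfl).trans (h0 j)).trans
        (hmono (by omega))
  · obtain ⟨i, rfl⟩ := Nat.exists_eq_add_of_le' (by omega : 2 ≤ i)
    by_cases hj : j ≤ 1
    · rw [Subgroup.commutator_comm]
      exact ((Subgroup.commutator_mono (hmono (Nat.zero_le j)) le_rfl).trans (h0 i)).trans
        (hmono (by omega))
    · obtain ⟨j, rfl⟩ := Nat.exists_eq_add_of_le' (by omega : 2 ≤ j)
      rw [show i + 2 + (j + 2) = (i + j + 2) + 2 by ring]
      exact (isFiltration_gamma.commutator_le (d + i) (d + j)).trans (gamma_antitone (by omega))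

/-- Already `k` lies in the second term, so its triangular powers have level 0 and no expansion of
the conjugates is needed. -/
theorem conj_triangular_mem_polySeq_deepFiltration (x : G) {d : ℕ} (hd : 2 ≤ d) {k : G}
    (hk : k ∈ gamma G d) :
    (fun m : ℕ => (k ^ (m + 1).choose 2)⁻¹ * x * k ^ (m + 1).choose 2) ∈
      polySeq (deepFiltration x d) (isFiltration_deepFiltration x hd) 1 := by
  have hF := isFiltration_deepFiltration x hd
  refine (isFiltration_polySeq hF).conj_mem' (i := 0)
    (pow_choose_add_mem_polySeq hF (i := 0) (j := 2) hk 1) (const_mem_polySeq hF ?_)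
  exact le_sup_left (α := Subgroup G) (Subgroup.mem_zpowers x)

theorem pow_choose_eq_one_of_mem_deepFiltration {p e d : ℕ} (hp : p.Prime) (hp2 : 2 < p)
    (hbot : gamma G (d + 6) = ⊥) (hexp : ∀ a : G, a ^ p ^ e = 1)
    (hexp' : ∀ a ∈ gamma G (d + 1), a ^ p ^ (e - 1) = 1) {x : G} {j : ℕ} (hj : 1 ≤ j) {a : G}
    (ha : a ∈ deepFiltration x d j) : a ^ (p ^ e).choose j = 1 := by
  rcases hj.eq_or_lt with rfl | h2
  · rw [Nat.choose_one_right]; exact hexp a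
  obtain ⟨m, rfl⟩ := Nat.exists_eq_add_of_le' (by omega : 2 ≤ j)
  change a ∈ gamma G (d + m) at ha
  -- At `j = 2` the term `γ_d` may have full exponent, but no factor is lost as `p` is odd.
  rcases Nat.eq_zero_or_pos m with rfl | hm
  · exact pow_eq_one_of_dvd (hexp a) (prime_pow_dvd_choose hp e (by omega)
      fun h => absurd (Nat.le_of_dvd (by omega) h) (by omega))
  rcases le_or_gt 6 m with h6 | h6
  · rw [gamma_eq_bot_of_le hbot (by omega), Subgroup.mem_bot] at ha
    rw [ha, one_pow]
  · exact pow_eq_one_of_dvd (hexp' a (gamma_antitone (by omega) ha))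
      (prime_pow_pred_dvd_choose hp e hj (not_sq_dvd hp2 hj (by omega) (by omega)))

end deep

/-! ### Conclusion. -/

theorem witnessProd_eq_one_of_mem_gamma {G : Type*} [Group G] {p e d : ℕ} (hp : p.Prime)
    (hp2 : 2 < p) (hd : 1 ≤ d) (hbot : gamma G (d + 6) = ⊥) (hexp : ∀ a : G, a ^ p ^ e = 1)
    (hexp' : ∀ a ∈ gamma G (d + 1), a ^ p ^ (e - 1) = 1) {k : G} (hk : k ∈ gamma G d) (x : G) :
    witnessProd k x (p ^ e) = 1 := by
  have hodd : Odd (p ^ e) := (hp.odd_of_ne_two hp2.ne').pow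
  rcases hd.eq_or_lt with rfl | hd2
  · obtain ⟨c, hc, hmem⟩ := conj_triangular_mem_polySeq hbot k x
    exact witnessProd_eq_one _ hmem hodd (hexp k) fun j hj a ha =>
      pow_choose_eq_one_of_mem_sixFiltration hbot hp hp2 hexp hexp' hc hj ha
  · exact witnessProd_eq_one _ (conj_triangular_mem_polySeq_deepFiltration x hd2 hk) hodd (hexp k)
      fun j hj a ha => pow_choose_eq_one_of_mem_deepFiltration hp hp2 hbot hexp hexp' hj ha

theorem exponent_subgroup_dvd {G : Type*} [Group G] (H : Subgroup G) :
    Monoid.exponent H ∣ Monoid.exponent G :=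
  Monoid.exponent_dvd_of_forall_pow_eq_one fun h => Subtype.ext <| by
    simpa using Monoid.pow_exponent_eq_one (h : G)

end JGroups

theorem mainTheorem2 (p : ℕ) (hp : p.Prime) (hp2 : 2 < p)
    (G : Type*) [Group G] [Finite G] (hG : IsPGroup p G)
    (c : ℕ) (hc : Group.nilpotencyClass G = c)
    (d : ℕ)
    (hd : IsGreatest
      {i : ℕ | 1 ≤ i ∧ Monoid.exponent (JGroups.gamma G i) = Monoid.exponent G} d)
    (hdc : (d : ℤ) ≥ (c : ℤ) - 5) :
    JGroups.IsJGroup G ∧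
      (Subtype.val '' JGroups.bigElements (JGroups.gamma G d) : Set G) ⊆ JGroups.witnesses G := by
  have : Fact p.Prime := ⟨hp⟩
  have : Group.IsNilpotent G := hG.isNilpotent
  obtain ⟨⟨hd1, hdexp⟩, hmax⟩ := hd
  obtain ⟨n, hn⟩ := IsPGroup.iff_card.1 hG
  obtain ⟨e, -, he⟩ := (Nat.dvd_prime_pow hp).1 (hn ▸ Group.exponent_dvd_nat_card (G := G))
  have hexp : ∀ a : G, a ^ p ^ e = 1 := fun a => by
    rw [← he]; exact Monoid.pow_exponent_eq_one a
  have hexp' : ∀ a ∈ JGroups.gamma G (d + 1), a ^ p ^ (e - 1) = 1 := by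
    intro a ha
    obtain ⟨f, hf, hf'⟩ := (Nat.dvd_prime_pow hp).1
      (he ▸ JGroups.exponent_subgroup_dvd (JGroups.gamma G (d + 1)))
    -- Equality would put `d + 1` in the set whose maximum is `d`.
    have hne : f ≠ e := by
      rintro rfl
      have := hmax ⟨Nat.le_add_left 1 d, hf'.trans he.symm⟩
      omega
    have h1 := Monoid.pow_exponent_eq_one (⟨a, ha⟩ : JGroups.gamma G (d + 1))
    rw [hf'] at h1
    exact JGroups.pow_eq_one_of_dvd (by simpa using congrArg Subtype.val h1)
      (pow_dvd_pow p (by omega : f ≤ e - 1))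
  have hbot : JGroups.gamma G (d + 6) = ⊥ := JGroups.gamma_eq_bot hc (by omega)
  have hwit : (Subtype.val '' JGroups.bigElements (JGroups.gamma G d) : Set G) ⊆
      JGroups.witnesses G := by
    rintro _ ⟨⟨k, hk⟩, hbig, rfl⟩
    have horder : orderOf k = p ^ e := by
      rw [← he, ← hdexp, ← (hbig : orderOf _ = _), Subgroup.orderOf_mk]
    refine ⟨isOfFinOrder_of_finite k, fun x => ?_⟩
    simp only [horder]
    exact JGroups.witnessProd_eq_one_of_mem_gamma hp hp2 hd1 hbot hexp hexp' hk x
  refine ⟨?_, hwit⟩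
  obtain ⟨k, hk⟩ := hp.exists_orderOf_eq_pow_factorization_exponent (JGroups.gamma G d)
  refine JGroups.isJGroup_of_mem_witnesses (hwit ⟨k, ?_, rfl⟩)
  change orderOf k = Monoid.exponent (JGroups.gamma G d)
  rw [hk, hdexp, he, hp.factorization_pow, Finsupp.single_eq_same]
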